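/- Let $H$ be an arbitrary (complex) Hilbert space, let $\mathcal K=\mathcal K(H)$ be the $C^*$-algebra of compact operators on $H$, let $A$ be a $C^*$-algebra with multiplier algebra $M(A)$, and let $\iota:\mathcal K\to M(A)$ be a nondegenerate $*$-homomorphism, i.e. one such that the products $\iota(k)a$ ($k\in\mathcal K$, $a\in A$) span a dense subspace of $A$. Let $$C(A,\iota)=\{m\in M(A): m\,\iota(k)=\iota(k)\,m\in A\ \text{ for all } k\in\mathcal K\},$$ a $C^*$-subalgebra of $M(A)$, and let $\otimes$ denote the minimal tensor product of $C^*$-algebras. Then there is a $*$-isomorphism $$\theta: C(A,\iota)\otimes\mathcal K\longrightarrow A$$ given on elementary tensors by $\theta(m\otimes k)=m\,\iota(k)$ for all $m\in C(A,\iota)$ and $k\in\mathcal K$. No separability of $H$ or $A$ is assumed. -/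

import Mathlib

open scoped TensorProduct MultiplierAlgebra

universe u v

noncomputable section

/-! ## Compact operators on a Hilbert space -/

section Compact

variable (H : Type v) [NormedAddCommGroup H] [InnerProductSpace ℂ H] [CompleteSpace H]

/-- The adjoint of a compact operator on a Hilbert space is compact. -/
theorem isCompactOperator_adjoint {T : H →L[ℂ] H} (hT : IsCompactOperator T) :
    IsCompactOperator (star T : H →L[ℂ] H) := by
  have hS : IsCompactOperator ((T * star T : H →L[ℂ] H)) := hT.comp_clm (star T)
  change IsCompactOperator ((star T : H →L[ℂ] H) : H →ₗ[ℂ] H)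
  rw [isCompactOperator_iff_isCompact_closure_image_closedBall _ zero_lt_one]
  refine TotallyBounded.isCompact_of_isClosed (TotallyBounded.closure ?_) isClosed_closure
  have hK := (hS.isCompact_closure_image_closedBall
    (f := ((T * star T : H →L[ℂ] H) : H →ₗ[ℂ] H)) 1).totallyBounded.subset subset_closure
  rw [Metric.totallyBounded_iff] at *
  intro ε hε
  have hδ : 0 < ε ^ 2 / 4 := by positivity
  obtain ⟨t, ht, htK⟩ := (totallyBounded_iff_subset.mp (Metric.totallyBounded_iff.mpr hK))
    _ (Metric.dist_mem_uniformity hδ)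
  obtain ⟨htf, htK⟩ := htK
  choose! p hp using fun y (hy : y ∈ t) => ht hy
  refine ⟨(fun y => star T (p y)) '' t, htf.image _, ?_⟩
  rintro _ ⟨x, hx, rfl⟩
  have := htK ⟨x, hx, rfl⟩
  simp only [Set.mem_iUnion, exists_prop] at this ⊢
  obtain ⟨y, hy, hxy⟩ := this
  refine ⟨_, ⟨y, hy, rfl⟩, ?_⟩
  obtain ⟨hpy, hpy'⟩ := hp y hy
  have h1 : ‖x - p y‖ ≤ 2 := by
    have a1 : ‖x‖ ≤ 1 := by simpa using hx
    have a2 : ‖p y‖ ≤ 1 := by simpa using hpy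
    linarith [norm_sub_le x (p y)]
  have h2 : ‖T (star T (x - p y))‖ < ε ^ 2 / 4 := by
    have : dist ((T * star T) x) y < ε ^ 2 / 4 := hxy
    rw [← hpy', dist_eq_norm] at this
    simpa [map_sub] using this
  have h3 : ‖star T (x - p y)‖ ^ 2 ≤ ‖x - p y‖ * ‖T (star T (x - p y))‖ := by
    have := norm_inner_le_norm (𝕜 := ℂ) (x - p y) (T (star T (x - p y)))
    rw [← ContinuousLinearMap.adjoint_inner_left, ← ContinuousLinearMap.star_eq_adjoint,
      inner_self_eq_norm_sq_to_K] at this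
    simpa using this
  rw [Metric.mem_ball, dist_eq_norm]
  change ‖star T x - star T (p y)‖ < ε
  rw [← map_sub]
  refine lt_of_pow_lt_pow_left₀ 2 hε.le ?_
  nlinarith [norm_nonneg (x - p y), norm_nonneg (T (star T (x - p y)))]

/-- The C⋆-algebra `K(H)` of compact operators on the Hilbert space `H`. -/
def compactOperators : NonUnitalStarSubalgebra ℂ (H →L[ℂ] H) where
  carrier := {T | IsCompactOperator T}
  zero_mem' := isCompactOperator_zero
  add_mem' hS hT := IsCompactOperator.add hS hT
  smul_mem' c _ hT := IsCompactOperator.smul hT c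
  mul_mem' {_ T} hS _ := IsCompactOperator.comp_clm hS T
  star_mem' hT := isCompactOperator_adjoint H hT

instance isClosed_compactOperators :
    IsClosed (compactOperators H : Set (H →L[ℂ] H)) :=
  isClosed_setOfPred_isCompactOperator

end Compact

/-! ## Nondegenerate homomorphisms into multiplier algebras, and relative commutants -/

section Multiplier

variable {A : Type u} [NonUnitalCStarAlgebra A]

/-- A homomorphism `φ : B → M(A)` is nondegenerate if the products `φ(b)a` span a dense subspace
of `A`. Here `(φ b).fst : A →L[ℂ] A` is left multiplication by the multiplier `φ b`. -/
def IsNondegenerate {B : Type v} [NonUnitalCStarAlgebra B] (φ : B →⋆ₙₐ[ℂ] 𝓜(ℂ, A)) : Prop :=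
  Dense (Submodule.span ℂ {x : A | ∃ (b : B) (a : A), x = (φ b).fst a} : Set A)

/-- The canonical embedding of `A` in `M(A)` is isometric. -/
theorem isometry_coeMultiplier : Isometry (DoubleCentralizer.coe ℂ : A → 𝓜(ℂ, A)) :=
  AddMonoidHomClass.isometry_of_norm (DoubleCentralizer.coeHom (𝕜 := ℂ) (A := A)) fun a => by
    rw [DoubleCentralizer.coeHom_apply, ← DoubleCentralizer.norm_fst, DoubleCentralizer.coe_fst,
      ContinuousLinearMap.opNorm_mul_apply]

/-- The relative commutant
`C(A, ι) = {m ∈ M(A) : m ι(k) = ι(k) m ∈ A for all k}` of `ι : B → M(A)`. -/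
def relativeCommutant {B : Type v} [NonUnitalCStarAlgebra B] (ι : B →⋆ₙₐ[ℂ] 𝓜(ℂ, A)) :
    NonUnitalStarSubalgebra ℂ 𝓜(ℂ, A) where
  carrier := {m | ∀ k : B, m * ι k = ι k * m ∧ ∃ a : A, (a : 𝓜(ℂ, A)) = m * ι k}
  zero_mem' k := ⟨by simp, 0, by
    rw [zero_mul]; exact map_zero (DoubleCentralizer.coeHom (𝕜 := ℂ) (A := A))⟩
  add_mem' {m n} hm hn k := by
    obtain ⟨h, a, ha⟩ := hm k
    obtain ⟨h', b, hb⟩ := hn k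
    refine ⟨by rw [add_mul, mul_add, h, h'], a + b, ?_⟩
    rw [add_mul, ← ha, ← hb]
    exact map_add (DoubleCentralizer.coeHom (𝕜 := ℂ) (A := A)) a b
  smul_mem' c m hm k := by
    obtain ⟨h, a, ha⟩ := hm k
    refine ⟨by rw [smul_mul_assoc, mul_smul_comm, h], c • a, ?_⟩
    rw [smul_mul_assoc, ← ha]
    exact map_smul (DoubleCentralizer.coeHom (𝕜 := ℂ) (A := A)) c a
  mul_mem' {m n} hm hn k := by
    obtain ⟨h, a, ha⟩ := hm k
    obtain ⟨h', b, hb⟩ := hn k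
    refine ⟨by rw [mul_assoc, h', ← mul_assoc, h, mul_assoc], m.fst b, ?_⟩
    rw [mul_assoc, ← hb]
    ext x
    · change m.fst b * x = m.fst (b * x)
      have key : ∀ y : A, y * (m.fst b * x) = y * m.fst (b * x) := fun y => by
        rw [← mul_assoc, ← m.central, mul_assoc, m.central]
      rw [← sub_eq_zero, ← CStarRing.star_mul_self_eq_zero_iff, mul_sub, key, sub_self]
    · exact (m.central x b).symm
  star_mem' {m} hm k := by
    obtain ⟨h, a, ha⟩ := hm (star k)
    have h1 : star m * ι k = star (m * ι (star k)) := by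
      rw [h, star_mul, map_star, star_star]
    have h2 : ι k * star m = star (m * ι (star k)) := by
      rw [star_mul, map_star, star_star]
    refine ⟨h1.trans h2.symm, star a, ?_⟩
    rw [h1, ← ha]
    exact map_star (DoubleCentralizer.coeHom (𝕜 := ℂ) (A := A)) a

instance isClosed_relativeCommutant {B : Type v} [NonUnitalCStarAlgebra B]
    (ι : B →⋆ₙₐ[ℂ] 𝓜(ℂ, A)) : IsClosed (relativeCommutant ι : Set 𝓜(ℂ, A)) := by
  have hA : IsClosed (Set.range (DoubleCentralizer.coe ℂ : A → 𝓜(ℂ, A))) :=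
    isometry_coeMultiplier.isClosedEmbedding.isClosed_range
  change IsClosed {m : 𝓜(ℂ, A) | ∀ k : B, m * ι k = ι k * m ∧
    m * ι k ∈ Set.range (DoubleCentralizer.coe ℂ : A → 𝓜(ℂ, A))}
  simp only [Set.ofPred_forall, Set.ofPred_and]
  exact isClosed_iInter fun k =>
    (isClosed_eq (continuous_mul_const _) (continuous_const_mul _)).inter
      (hA.preimage (continuous_mul_const _))

end Multiplier

/-! ## The minimal tensor product of C⋆-algebras -/

/-- A representation of the C⋆-algebra `B` on a Hilbert space. -/
structure HilbertRep (B : Type u) [NonUnitalCStarAlgebra B] where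
  space : Type u
  [normedAddCommGroup : NormedAddCommGroup space]
  [innerProductSpace : InnerProductSpace ℂ space]
  [completeSpace : CompleteSpace space]
  hom : B →⋆ₙₐ[ℂ] (space →L[ℂ] space)

attribute [instance] HilbertRep.normedAddCommGroup HilbertRep.innerProductSpace
  HilbertRep.completeSpace

section MinTensor

variable {B : Type u} {D : Type v} [NonUnitalCStarAlgebra B] [NonUnitalCStarAlgebra D]

/-- The algebraic tensor product of the Hilbert spaces of two representations, as a pre-Hilbert
space with the inner product `⟪v ⊗ w, v' ⊗ w'⟫ = ⟪v, v'⟫ ⟪w, w'⟫`. -/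
def HilbertRep.TensorSpace (π : HilbertRep B) (ρ : HilbertRep D) : Type max u v :=
  π.space ⊗[ℂ] ρ.space

instance (π : HilbertRep B) (ρ : HilbertRep D) : NormedAddCommGroup (π.TensorSpace ρ) :=
  inferInstanceAs (NormedAddCommGroup (π.space ⊗[ℂ] ρ.space))

instance (π : HilbertRep B) (ρ : HilbertRep D) : InnerProductSpace ℂ (π.TensorSpace ρ) :=
  inferInstanceAs (InnerProductSpace ℂ (π.space ⊗[ℂ] ρ.space))

/-- The operator `S ⊗ T` on the tensor product of the Hilbert spaces of two representations. -/
def HilbertRep.tensorOp (π : HilbertRep B) (ρ : HilbertRep D) (S : π.space →L[ℂ] π.space)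
    (T : ρ.space →L[ℂ] ρ.space) : π.TensorSpace ρ →L[ℂ] π.TensorSpace ρ :=
  TensorProduct.mapL S T

theorem HilbertRep.norm_tensorOp_le (π : HilbertRep B) (ρ : HilbertRep D)
    (S : π.space →L[ℂ] π.space) (T : ρ.space →L[ℂ] ρ.space) :
    ‖π.tensorOp ρ S T‖ ≤ ‖S‖ * ‖T‖ :=
  TensorProduct.norm_mapL_le S T

/-- The tensor product `π ⊗ ρ` of two representations, as a representation of the algebraic tensor
product of the algebras on the tensor product of the Hilbert spaces, with
`(π ⊗ ρ)(b ⊗ d) = π(b) ⊗ ρ(d)`. The operators are bounded, so they extend to the Hilbert space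
completion with the same norm. -/
def HilbertRep.tensor (π : HilbertRep B) (ρ : HilbertRep D) :
    B ⊗[ℂ] D →ₗ[ℂ] (π.TensorSpace ρ →L[ℂ] π.TensorSpace ρ) :=
  TensorProduct.lift <| LinearMap.mk₂ ℂ (fun b d => π.tensorOp ρ (π.hom b) (ρ.hom d))
    (fun b b' d => by rw [map_add]; exact TensorProduct.mapL_add_left _ _ _)
    (fun c b d => by rw [map_smul]; exact TensorProduct.mapL_smul_left _ _ _)
    (fun b d d' => by rw [map_add]; exact TensorProduct.mapL_add_right _ _ _)
    (fun c b d => by rw [map_smul]; exact TensorProduct.mapL_smul_right _ _ _)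

theorem HilbertRep.tensor_tmul (π : HilbertRep B) (ρ : HilbertRep D) (b : B) (d : D) :
    π.tensor ρ (b ⊗ₜ d) = π.tensorOp ρ (π.hom b) (ρ.hom d) := rfl

theorem HilbertRep.tensor_mul (π : HilbertRep B) (ρ : HilbertRep D) (x y : B ⊗[ℂ] D) :
    π.tensor ρ (x * y) = π.tensor ρ x * π.tensor ρ y := by
  induction x with
  | zero => simp
  | add x x' hx hx' => rw [add_mul, map_add, map_add, add_mul, hx, hx']
  | tmul b d =>
    induction y with
    | zero => simp
    | add y y' hy hy' => rw [mul_add, map_add, map_add, mul_add, hy, hy']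
    | tmul b' d' =>
      rw [Algebra.TensorProduct.tmul_mul_tmul]
      simp only [HilbertRep.tensor_tmul, map_mul]
      exact TensorProduct.mapL_mul _ _ _ _

theorem HilbertRep.inner_mapL_star {E : Type u} {F : Type v} [NormedAddCommGroup E]
    [InnerProductSpace ℂ E] [CompleteSpace E] [NormedAddCommGroup F] [InnerProductSpace ℂ F]
    [CompleteSpace F] (S : E →L[ℂ] E) (T : F →L[ℂ] F) (v w : E ⊗[ℂ] F) :
    inner ℂ (TensorProduct.mapL (star S) (star T) v) w = inner ℂ v (TensorProduct.mapL S T w) := by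
  induction v with
  | zero => simp
  | add v v' hv hv' => simp only [map_add, inner_add_left, hv, hv']
  | tmul v₁ v₂ =>
    induction w with
    | zero => simp
    | add w w' hw hw' => simp only [map_add, inner_add_right, hw, hw']
    | tmul w₁ w₂ =>
      simp only [TensorProduct.mapL_tmul, TensorProduct.inner_tmul,
        ContinuousLinearMap.star_eq_adjoint, ContinuousLinearMap.adjoint_inner_left]

theorem HilbertRep.inner_tensor_star (π : HilbertRep B) (ρ : HilbertRep D) (x : B ⊗[ℂ] D)
    (v w : π.TensorSpace ρ) :
    inner ℂ (π.tensor ρ (star x) v) w = inner ℂ v (π.tensor ρ x w) := by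
  induction x with
  | zero => simp
  | add x x' hx hx' => rw [star_add, map_add, map_add, add_apply,
      add_apply, inner_add_left, inner_add_right, hx, hx']
  | tmul b d =>
    rw [TensorProduct.star_tmul, HilbertRep.tensor_tmul, HilbertRep.tensor_tmul, map_star, map_star]
    exact HilbertRep.inner_mapL_star _ _ v w

theorem HilbertRep.norm_tensor_sq_le (π : HilbertRep B) (ρ : HilbertRep D) (x : B ⊗[ℂ] D) :
    ‖π.tensor ρ x‖ * ‖π.tensor ρ x‖ ≤ ‖π.tensor ρ (star x * x)‖ := by
  have h : ∀ v, ‖π.tensor ρ x v‖ ≤ √‖π.tensor ρ (star x * x)‖ * ‖v‖ := fun v => by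
    refine le_of_sq_le_sq ?_ (by positivity)
    rw [mul_pow, Real.sq_sqrt (norm_nonneg _), ← inner_self_eq_norm_sq (𝕜 := ℂ),
      ← HilbertRep.inner_tensor_star, ← mul_apply_eq_comp, ← HilbertRep.tensor_mul]
    refine (Complex.re_le_norm _).trans ((norm_inner_le_norm _ _).trans ?_)
    nlinarith [(π.tensor ρ (star x * x)).le_opNorm v, norm_nonneg v]
  have h' := ContinuousLinearMap.opNorm_le_bound _ (Real.sqrt_nonneg _) h
  calc _ ≤ √‖π.tensor ρ (star x * x)‖ * √‖π.tensor ρ (star x * x)‖ := by gcongr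
    _ = _ := Real.mul_self_sqrt (norm_nonneg _)

theorem HilbertRep.norm_tensor_star_le (π : HilbertRep B) (ρ : HilbertRep D) (x : B ⊗[ℂ] D) :
    ‖π.tensor ρ (star x)‖ ≤ ‖π.tensor ρ x‖ := by
  have h := π.norm_tensor_sq_le ρ (star x)
  rw [star_star, HilbertRep.tensor_mul] at h
  have h' := h.trans (norm_mul_le _ _)
  by_contra! hlt
  nlinarith [norm_nonneg (π.tensor ρ x)]

theorem bddAbove_norm_tensor (x : B ⊗[ℂ] D) :
    BddAbove (Set.range fun p : HilbertRep B × HilbertRep D => ‖p.1.tensor p.2 x‖) := by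
  suffices ∃ C, ∀ p : HilbertRep B × HilbertRep D, ‖p.1.tensor p.2 x‖ ≤ C by
    obtain ⟨C, hC⟩ := this
    exact ⟨C, by rintro _ ⟨p, rfl⟩; exact hC p⟩
  induction x with
  | zero => exact ⟨0, fun p => by simp⟩
  | add x y hx hy =>
    obtain ⟨C, hC⟩ := hx
    obtain ⟨C', hC'⟩ := hy
    refine ⟨C + C', fun p => ?_⟩
    rw [map_add]
    exact (norm_add_le _ _).trans (add_le_add (hC p) (hC' p))
  | tmul b d =>
    refine ⟨‖b‖ * ‖d‖, fun p => (p.1.norm_tensorOp_le p.2 _ _).trans ?_⟩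
    gcongr
    · exact NonUnitalStarAlgHom.norm_apply_le p.1.hom b
    · exact NonUnitalStarAlgHom.norm_apply_le p.2.hom d

/-- The minimal (spatial) C⋆-norm on the algebraic tensor product:
`‖x‖ = sup ‖(π ⊗ ρ)(x)‖` over all representations `π` of `B` and `ρ` of `D`. -/
def minTensorNorm (x : B ⊗[ℂ] D) : ℝ :=
  ⨆ p : HilbertRep B × HilbertRep D, ‖p.1.tensor p.2 x‖

theorem le_minTensorNorm (π : HilbertRep B) (ρ : HilbertRep D) (x : B ⊗[ℂ] D) :
    ‖π.tensor ρ x‖ ≤ minTensorNorm x :=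
  le_ciSup (bddAbove_norm_tensor x) (π, ρ)

theorem minTensorNorm_nonneg (x : B ⊗[ℂ] D) : 0 ≤ minTensorNorm x :=
  Real.iSup_nonneg fun _ => norm_nonneg _

theorem minTensorNorm_le {x : B ⊗[ℂ] D} {C : ℝ} (hC : 0 ≤ C)
    (h : ∀ (π : HilbertRep B) (ρ : HilbertRep D), ‖π.tensor ρ x‖ ≤ C) : minTensorNorm x ≤ C :=
  Real.iSup_le (fun p => h p.1 p.2) hC

theorem minTensorNorm_mul_le (x y : B ⊗[ℂ] D) :
    minTensorNorm (x * y) ≤ minTensorNorm x * minTensorNorm y := by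
  refine minTensorNorm_le (mul_nonneg (minTensorNorm_nonneg x) (minTensorNorm_nonneg y))
    fun π ρ => ?_
  rw [HilbertRep.tensor_mul]
  exact (norm_mul_le _ _).trans (mul_le_mul (le_minTensorNorm π ρ x) (le_minTensorNorm π ρ y)
    (norm_nonneg _) (minTensorNorm_nonneg x))

theorem minTensorNorm_smul (c : ℂ) (x : B ⊗[ℂ] D) :
    minTensorNorm (c • x) = ‖c‖ * minTensorNorm x := by
  simp only [minTensorNorm, map_smul, norm_smul]
  exact (Real.mul_iSup_of_nonneg (norm_nonneg c) _).symm

theorem minTensorNorm_star (x : B ⊗[ℂ] D) : minTensorNorm (star x) = minTensorNorm x := by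
  have h : ∀ y : B ⊗[ℂ] D, minTensorNorm (star y) ≤ minTensorNorm y := fun y =>
    minTensorNorm_le (minTensorNorm_nonneg y) fun π ρ =>
      (π.norm_tensor_star_le ρ y).trans (le_minTensorNorm π ρ y)
  exact (h x).antisymm (by simpa using h (star x))

theorem minTensorNorm_sq_le (x : B ⊗[ℂ] D) :
    minTensorNorm x * minTensorNorm x ≤ minTensorNorm (star x * x) := by
  have h : minTensorNorm x ≤ √(minTensorNorm (star x * x)) :=
    minTensorNorm_le (Real.sqrt_nonneg _) fun π ρ => Real.le_sqrt_of_sq_le <| by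
      rw [sq]
      exact (π.norm_tensor_sq_le ρ x).trans (le_minTensorNorm π ρ _)
  calc _ ≤ √(minTensorNorm (star x * x)) * √(minTensorNorm (star x * x)) :=
        mul_le_mul h h (minTensorNorm_nonneg x) (Real.sqrt_nonneg _)
    _ = _ := Real.mul_self_sqrt (minTensorNorm_nonneg _)

theorem star_mul_tensor (x y : B ⊗[ℂ] D) : star (x * y) = star y * star x := by
  induction x with
  | zero => simp
  | add x x' hx hx' => rw [add_mul, star_add, star_add, mul_add, hx, hx']
  | tmul b d =>
    induction y with
    | zero => simp
    | add y y' hy hy' => rw [mul_add, star_add, star_add, add_mul, hy, hy']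
    | tmul b' d' => simp [Algebra.TensorProduct.tmul_mul_tmul]

variable (B D) in
/-- The algebraic tensor product of two C⋆-algebras, equipped with the minimal C⋆-norm. -/
def AlgMinTensor : Type max u v := B ⊗[ℂ] D

namespace AlgMinTensor

instance : NonUnitalRing (AlgMinTensor B D) := inferInstanceAs (NonUnitalRing (B ⊗[ℂ] D))

instance : Module ℂ (AlgMinTensor B D) := inferInstanceAs (Module ℂ (B ⊗[ℂ] D))

instance : IsScalarTower ℂ (AlgMinTensor B D) (AlgMinTensor B D) :=
  inferInstanceAs (IsScalarTower ℂ (B ⊗[ℂ] D) (B ⊗[ℂ] D))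

instance : SMulCommClass ℂ (AlgMinTensor B D) (AlgMinTensor B D) :=
  inferInstanceAs (SMulCommClass ℂ (B ⊗[ℂ] D) (B ⊗[ℂ] D))

instance : StarRing (AlgMinTensor B D) where
  __ := (inferInstance : StarAddMonoid (B ⊗[ℂ] D))
  star_mul x y := star_mul_tensor (B := B) (D := D) x y

instance : StarModule ℂ (AlgMinTensor B D) := inferInstanceAs (StarModule ℂ (B ⊗[ℂ] D))

variable (B D) in
/-- The minimal C⋆-norm as a seminorm. -/
def seminorm : Seminorm ℂ (AlgMinTensor B D) :=
  Seminorm.of (fun x => minTensorNorm (B := B) (D := D) x)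
    (fun x y => minTensorNorm_le (add_nonneg (minTensorNorm_nonneg _) (minTensorNorm_nonneg _))
      fun π ρ => (congrArg norm (map_add (π.tensor ρ) x y)).trans_le <|
        (norm_add_le _ _).trans (add_le_add (le_minTensorNorm π ρ x) (le_minTensorNorm π ρ y)))
    (fun c x => minTensorNorm_smul (B := B) (D := D) c x)

instance : SeminormedAddCommGroup (AlgMinTensor B D) :=
  (seminorm B D).toAddGroupSeminorm.toSeminormedAddCommGroup

instance : NonUnitalSeminormedRing (AlgMinTensor B D) where
  __ := (inferInstance : SeminormedAddCommGroup (AlgMinTensor B D))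
  __ := (inferInstance : NonUnitalRing (AlgMinTensor B D))
  norm_mul_le x y := minTensorNorm_mul_le (B := B) (D := D) x y

instance : NormedSpace ℂ (AlgMinTensor B D) where
  norm_smul_le c x := (map_smul_eq_mul (seminorm B D) c x).le

theorem norm_def (x : AlgMinTensor B D) : ‖x‖ = minTensorNorm (B := B) (D := D) x := rfl

instance : NormedStarGroup (AlgMinTensor B D) where
  norm_star_le x := (minTensorNorm_star (B := B) (D := D) x).le

end AlgMinTensor

variable (B D) in
/-- The minimal tensor product `B ⊗ D` of two C⋆-algebras: the (Hausdorff) completion of the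
algebraic tensor product for the minimal C⋆-norm. -/
def MinTensor : Type max u v := UniformSpace.Completion (AlgMinTensor B D)

namespace MinTensor

open UniformSpace

instance : NormedAddCommGroup (MinTensor B D) :=
  inferInstanceAs (NormedAddCommGroup (Completion (AlgMinTensor B D)))

instance : NormedSpace ℂ (MinTensor B D) :=
  inferInstanceAs (NormedSpace ℂ (Completion (AlgMinTensor B D)))

instance : CompleteSpace (MinTensor B D) :=
  inferInstanceAs (CompleteSpace (Completion (AlgMinTensor B D)))

/-- The canonical map from the algebraic tensor product to the minimal tensor product. -/
def of : B ⊗[ℂ] D →ₗ[ℂ] MinTensor B D :=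
  (Completion.toComplₗᵢ (𝕜 := ℂ) (E := AlgMinTensor B D)).toLinearMap

/-- The elementary tensor `b ⊗ d` in the minimal tensor product. -/
def tmul (b : B) (d : D) : MinTensor B D := of (b ⊗ₜ[ℂ] d)

theorem norm_of (x : B ⊗[ℂ] D) : ‖(of x : MinTensor B D)‖ = minTensorNorm x :=
  (Completion.toComplₗᵢ (𝕜 := ℂ) (E := AlgMinTensor B D)).norm_map x

theorem isDenseInducing_of :
    IsDenseInducing (fun x : AlgMinTensor B D => (of (B := B) (D := D) x)) :=
  Completion.isDenseInducing_coe

theorem denseRange_of : DenseRange (of : B ⊗[ℂ] D → MinTensor B D) :=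
  isDenseInducing_of.dense

theorem continuous_of :
    Continuous (fun x : AlgMinTensor B D => (of (B := B) (D := D) x)) :=
  isDenseInducing_of.continuous

instance : Mul (MinTensor B D) where
  mul x y := (isDenseInducing_of.prodMap isDenseInducing_of).extend
    (fun p : AlgMinTensor B D × AlgMinTensor B D => of (B := B) (D := D) (p.1 * p.2)) (x, y)

theorem of_mul (x y : B ⊗[ℂ] D) : (of (x * y) : MinTensor B D) = of x * of y :=
  ((isDenseInducing_of.prodMap isDenseInducing_of).extend_eq
    (continuous_of.comp (continuous_mul (M := AlgMinTensor B D))) (x, y)).symm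

instance : ContinuousMul (MinTensor B D) where
  continuous_mul := by
    let j : AlgMinTensor B D →+ MinTensor B D := (of (B := B) (D := D)).toAddMonoidHom
    let m := (AddMonoidHom.mul : AlgMinTensor B D →+ _ →+ AlgMinTensor B D).compr₂ j
    have hm : Continuous fun p : AlgMinTensor B D × AlgMinTensor B D => m p.1 p.2 :=
      continuous_of.comp continuous_mul
    have di : IsDenseInducing j := isDenseInducing_of
    exact (di.extend_Z_bilin di hm :)

instance : Star (MinTensor B D) where
  star := Completion.map (star : AlgMinTensor B D → AlgMinTensor B D)

theorem continuous_star' : Continuous (star : MinTensor B D → MinTensor B D) :=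
  Completion.continuous_map

theorem of_star (x : B ⊗[ℂ] D) : (of (star x) : MinTensor B D) = star (of x) :=
  (Completion.map_coe (f := (star : AlgMinTensor B D → AlgMinTensor B D))
    (starₗᵢ ℂ : AlgMinTensor B D ≃ₗᵢ⋆[ℂ] AlgMinTensor B D).isometry.uniformContinuous x).symm

instance : ContinuousStar (MinTensor B D) := ⟨continuous_star'⟩

instance : NonUnitalNormedRing (MinTensor B D) where
  __ := (inferInstance : NormedAddCommGroup (MinTensor B D))
  mul_assoc x y z := denseRange_of.induction_on₃
    (isClosed_eq (by fun_prop) (by fun_prop))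
    (fun a b c => by simp only [← of_mul, mul_assoc]) x y z
  left_distrib x y z := denseRange_of.induction_on₃
    (isClosed_eq (by fun_prop) (by fun_prop))
    (fun a b c => by simp only [← of_mul, ← map_add, mul_add]) x y z
  right_distrib x y z := denseRange_of.induction_on₃
    (isClosed_eq (by fun_prop) (by fun_prop))
    (fun a b c => by simp only [← of_mul, ← map_add, add_mul]) x y z
  zero_mul x := denseRange_of.induction_on x (isClosed_eq (by fun_prop) (by fun_prop))
    fun a => by rw [← map_zero of, ← of_mul, zero_mul]
  mul_zero x := denseRange_of.induction_on x (isClosed_eq (by fun_prop) (by fun_prop))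
    fun a => by rw [← map_zero of, ← of_mul, mul_zero]
  norm_mul_le x y := denseRange_of.induction_on₂
    (isClosed_le (by fun_prop) (by fun_prop))
    (fun a b => by simpa only [← of_mul, norm_of] using minTensorNorm_mul_le a b) x y

instance : StarRing (MinTensor B D) where
  star_involutive x := denseRange_of.induction_on x (isClosed_eq (by fun_prop) (by fun_prop))
    fun a => by rw [← of_star, ← of_star, star_star]
  star_mul x y := denseRange_of.induction_on₂
    (isClosed_eq (by fun_prop) (by fun_prop))
    (fun a b => by simp only [← of_mul, ← of_star, star_mul_tensor]) x y
  star_add x y := denseRange_of.induction_on₂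
    (isClosed_eq (by fun_prop) (by fun_prop))
    (fun a b => by simp only [← map_add, ← of_star, star_add]) x y

theorem smul_mul_assoc' (c : ℂ) (x y : MinTensor B D) : (c • x) * y = c • (x * y) :=
  denseRange_of.induction_on₂ (p := fun x y => (c • x) * y = c • (x * y))
    (isClosed_eq ((continuous_fst.const_smul c).mul continuous_snd)
      ((continuous_fst.mul continuous_snd).const_smul c))
    (fun a b => by rw [← of_mul, ← map_smul, ← map_smul, ← of_mul, smul_mul_assoc]) x y

theorem mul_smul_comm' (c : ℂ) (x y : MinTensor B D) : x * (c • y) = c • (x * y) :=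
  denseRange_of.induction_on₂ (p := fun x y => x * (c • y) = c • (x * y))
    (isClosed_eq (continuous_fst.mul (continuous_snd.const_smul c))
      ((continuous_fst.mul continuous_snd).const_smul c))
    (fun a b => by rw [← of_mul, ← map_smul, ← map_smul, ← of_mul, mul_smul_comm]) x y

instance : IsScalarTower ℂ (MinTensor B D) (MinTensor B D) := ⟨smul_mul_assoc'⟩

instance : SMulCommClass ℂ (MinTensor B D) (MinTensor B D) :=
  ⟨fun c x y => (mul_smul_comm' c x y).symm⟩

/-- The minimal tensor product is a C⋆-algebra. -/
instance : NonUnitalCStarAlgebra (MinTensor B D) where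
  norm_mul_self_le x := denseRange_of.induction_on
    (p := fun x : MinTensor B D => ‖x‖ * ‖x‖ ≤ ‖star x * x‖) x
    (isClosed_le (continuous_norm.mul continuous_norm)
      (continuous_star'.mul continuous_id).norm)
    fun a => by rw [← of_star, ← of_mul, norm_of, norm_of]; exact minTensorNorm_sq_le a
  star_smul c x := denseRange_of.induction_on
    (p := fun x : MinTensor B D => star (c • x) = star c • star x) x
    (isClosed_eq (continuous_star'.comp (continuous_const_smul c))
      (continuous_star'.const_smul (star c)))
    fun a => by rw [← of_star, ← map_smul, ← map_smul, ← of_star, star_smul]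

end MinTensor

end MinTensor

end

/-! The matrix units `E i j` of a Hilbert basis span a dense subspace of the compact operators, and
only this is used about them. Through `ι` they turn `A` into infinite matrices with entries in a
corner, and the relative commutant is that corner repeated down the diagonal.

Surjectivity: for `a` in `A` the strict sum `m = ∑ p, ι (E p i) a ι (E j p)` is in the relative
commutant and `m ι (E q r) = ι (E q i) a ι (E j r)` (`exists_mem_relativeCommutant`). The partial
sums are bounded because repeating a corner along orthogonal ranges is a star homomorphism, hence
contractive. By nondegeneracy the elements on the right span a dense subspace of `A`.

Isometry: up to approximation, an element of `C ⊗ D` involves finitely many matrix units, so it lies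
in a copy of the C⋆-algebra of finite matrices over `C`. Injective star homomorphisms there are
isometric, so any two star maps on `C ⊗ D` that are injective on entries give the same seminorm
(`IsMatrixUnits.norm_map_eq`). This applies to `m ⊗ k ↦ m ι(k)`, injective on entries by
nondegeneracy, and to the map into the minimal tensor product, injective on entries because
representations separate points. So the first map extends isometrically to the completion, with
closed range equal to `A`. All limits are along the finite subsets of the basis, which may be
uncountable. -/

/-! ### Positive functionals and separating representations -/

section States

open scoped ComplexOrder ComplexStarModule

/-- On a C⋆-algebra, every nonzero positive element is detected by a positive functional. -/
theorem exists_positiveLinearMap_apply_ne_zero {B : Type*} [NonUnitalCStarAlgebra B]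
    [PartialOrder B] [StarOrderedRing B] {a : B} (ha : 0 ≤ a) (ha0 : a ≠ 0) :
    ∃ f : B →ₚ[ℂ] ℂ, f a ≠ 0 := by
  have hneg : -a ∉ {x : B | 0 ≤ x} := fun h =>
    ha0 (le_antisymm (neg_nonneg.mp h) ha)
  have hconv : Convex ℝ {x : B | 0 ≤ x} := by
    intro x hx y hy s t hs ht _
    exact add_nonneg (smul_nonneg hs hx) (smul_nonneg ht hy)
  -- Hahn–Banach separates `-a` from the closed convex cone of positive elements.
  obtain ⟨g, r, hgr, hg⟩ :=
    geometric_hahn_banach_point_closed hconv CStarAlgebra.isClosed_nonneg hneg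
  have hr : r < 0 := by simpa using hg 0 (le_refl (0 : B))
  have hpos : ∀ x : B, 0 ≤ x → 0 ≤ g x := by
    intro x hx
    by_contra! hlt
    -- If `g x < 0`, this positive multiple of `x` has value exactly `r`, which the separation
    -- excludes.
    have h := hg ((r / g x) • x) (smul_nonneg (div_nonneg_of_nonpos hr.le hlt.le) hx)
    rw [map_smul, smul_eq_mul, div_mul_cancel₀ _ hlt.ne] at h
    exact lt_irrefl _ h
  have hga : 0 < g a := by
    rw [map_neg] at hgr
    linarith
  let f : B →ₗ[ℂ] ℂ :=
    { toFun x := (g (ℜ x : B) : ℂ) + Complex.I * g (ℑ x : B)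
      map_add' x y := by
        simp only [map_add, AddSubgroup.coe_add, Complex.ofReal_add]
        ring
      map_smul' c x := by
        simp only [realPart_smul, imaginaryPart_smul, AddSubgroup.coe_sub, AddSubgroup.coe_add,
          selfAdjoint.val_smul, map_add, map_sub, map_smul, smul_eq_mul, RingHom.id_apply]
        apply Complex.ext <;> simp }
  have hf : ∀ x : B, 0 ≤ x → f x = g x := fun x hx => by
    have hx' : IsSelfAdjoint x := .of_nonneg hx
    change (g (ℜ x : B) : ℂ) + Complex.I * g (ℑ x : B) = _
    rw [hx'.coe_realPart, hx'.imaginaryPart]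
    simp
  refine ⟨PositiveLinearMap.mk₀ f fun x hx => ?_, ?_⟩
  · rw [hf x hx]
    exact_mod_cast hpos x hx
  · change f a ≠ 0
    rw [hf a ha]
    exact_mod_cast hga.ne'

/-- The representations of a C⋆-algebra separate its points. -/
theorem HilbertRep.exists_hom_ne_zero {B : Type u} [NonUnitalCStarAlgebra B] {b : B}
    (hb : b ≠ 0) : ∃ π : HilbertRep B, π.hom b ≠ 0 := by
  let := CStarAlgebra.spectralOrder B
  have := CStarAlgebra.spectralOrderedRing B
  -- There is no unit to supply a cyclic vector, so `star b` serves as test vector: `b` sends its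
  -- GNS class to that of `a`, whose squared norm is `f (star a * a)`.
  set a := b * star b with ha
  have ha0 : a ≠ 0 := by rwa [ha, ne_eq, CStarRing.mul_star_self_eq_zero_iff]
  have hc : star a * a ≠ 0 := by rwa [ne_eq, CStarRing.star_mul_self_eq_zero_iff]
  obtain ⟨f, hf⟩ := exists_positiveLinearMap_apply_ne_zero (star_mul_self_nonneg a) hc
  refine ⟨⟨f.GNS, f.gnsNonUnitalStarAlgHom⟩, fun h => hf ?_⟩
  have h1 : f.gnsNonUnitalStarAlgHom b (f.toPreGNS (star b)) = 0 := by
    change f.gnsNonUnitalStarAlgHom b = 0 at h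
    rw [h]; rfl
  rw [f.gnsNonUnitalStarAlgHom_apply_coe] at h1
  have h2 : ‖f.leftMulMapPreGNS b (f.toPreGNS (star b))‖ = 0 := by
    rw [← UniformSpace.Completion.norm_coe, h1, norm_zero]
  have h3 := f.preGNS_norm_sq (f.leftMulMapPreGNS b (f.toPreGNS (star b)))
  rw [h2] at h3
  simpa [ha] using h3.symm

end States

/-- Elementary tensors of nonzero elements are nonzero in the minimal tensor product. -/
theorem MinTensor.tmul_ne_zero {B : Type u} {D : Type v} [NonUnitalCStarAlgebra B]
    [NonUnitalCStarAlgebra D] {b : B} {d : D} (hb : b ≠ 0) (hd : d ≠ 0) :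
    MinTensor.tmul b d ≠ 0 := by
  obtain ⟨π, hπ⟩ := HilbertRep.exists_hom_ne_zero hb
  obtain ⟨ρ, hρ⟩ := HilbertRep.exists_hom_ne_zero hd
  obtain ⟨v, hv⟩ := DFunLike.ne_iff.mp hπ
  obtain ⟨w, hw⟩ := DFunLike.ne_iff.mp hρ
  intro h
  have h0 : minTensorNorm (b ⊗ₜ[ℂ] d) = 0 := by
    rw [← MinTensor.norm_of]
    exact norm_eq_zero.mpr h
  have h1 : π.tensor ρ (b ⊗ₜ[ℂ] d) = 0 :=
    norm_le_zero_iff.mp (h0 ▸ le_minTensorNorm π ρ (b ⊗ₜ[ℂ] d))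
  have h2 : ‖(π.hom b v) ⊗ₜ[ℂ] (ρ.hom d w)‖ = 0 :=
    norm_eq_zero.mpr (DFunLike.congr_fun h1 (v ⊗ₜ[ℂ] w : π.space ⊗[ℂ] ρ.space))
  rw [TensorProduct.norm_tmul] at h2
  rcases mul_eq_zero.mp h2 with h | h
  · exact hv (norm_eq_zero.mp h)
  · exact hw (norm_eq_zero.mp h)

/-! ### Matrix units and their density in the compact operators -/

/-- A system of matrix units in a star algebra. -/
structure IsMatrixUnits {I D : Type*} [Mul D] [Zero D] [Star D] (E : I → I → D) : Prop where
  mul_same : ∀ i j k, E i j * E j k = E i k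
  mul_of_ne : ∀ i {j k} l, j ≠ k → E i j * E k l = 0
  star_apply : ∀ i j, star (E i j) = E j i
  ne_zero : ∀ i j, E i j ≠ 0

section Compact

variable {H : Type v} [NormedAddCommGroup H] [InnerProductSpace ℂ H] [CompleteSpace H]

open InnerProductSpace Filter Topology

/-- A rank one operator, as an element of the algebra of compact operators. -/
noncomputable def compactRankOne (x y : H) : compactOperators H :=
  ⟨rankOne ℂ x y, by
    change IsCompactOperator (rankOne ℂ x y)
    rw [rankOne_def']
    have h : IsCompactOperator (ContinuousLinearMap.toSpanSingleton ℂ x) :=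
      isCompactOperator_of_locallyCompactSpace_rng _
    exact h.comp_clm (innerSL ℂ y)⟩

variable {I : Type*} (b : HilbertBasis I ℂ H)

theorem HilbertBasis.isMatrixUnits :
    IsMatrixUnits (fun i j => compactRankOne (b i) (b j)) where
  mul_same i j k := by
    apply Subtype.ext
    change rankOne ℂ (b i) (b j) ∘L rankOne ℂ (b j) (b k) = rankOne ℂ (b i) (b k)
    rw [rankOne_comp_rankOne, inner_self_eq_norm_sq_to_K, b.orthonormal.1]
    simp
  mul_of_ne i j k l h := by
    apply Subtype.ext
    change rankOne ℂ (b i) (b j) ∘L rankOne ℂ (b k) (b l) = 0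
    rw [rankOne_comp_rankOne, b.orthonormal.2 h, zero_smul]
  star_apply i j := by
    apply Subtype.ext
    change star (rankOne ℂ (b i) (b j)) = rankOne ℂ (b j) (b i)
    rw [ContinuousLinearMap.star_eq_adjoint, adjoint_rankOne]
  ne_zero i j h := by
    have h1 : rankOne ℂ (b i) (b j) = 0 := congrArg Subtype.val h
    exact rankOne_ne_zero (b.orthonormal.ne_zero i) (b.orthonormal.ne_zero j) h1

/-- The projection onto the span of finitely many vectors of a Hilbert basis. -/
noncomputable def HilbertBasis.finsetProj (F : Finset I) : H →L[ℂ] H :=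
  ∑ i ∈ F, rankOne ℂ (b i) (b i)

theorem HilbertBasis.star_finsetProj (F : Finset I) : star (b.finsetProj F) = b.finsetProj F := by
  simp only [finsetProj, star_sum, ContinuousLinearMap.star_eq_adjoint, adjoint_rankOne]

theorem HilbertBasis.finsetProj_mul_self (F : Finset I) :
    b.finsetProj F * b.finsetProj F = b.finsetProj F := by
  simp only [finsetProj, Finset.sum_mul_sum]
  refine Finset.sum_congr rfl fun i hi => ?_
  rw [Finset.sum_eq_single_of_mem i hi]
  · exact congrArg Subtype.val (b.isMatrixUnits.mul_same i i i)
  · exact fun j _ hj => congrArg Subtype.val (b.isMatrixUnits.mul_of_ne i j hj.symm)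

theorem HilbertBasis.norm_finsetProj_le (F : Finset I) : ‖b.finsetProj F‖ ≤ 1 := by
  have h := CStarRing.norm_star_mul_self (x := b.finsetProj F)
  rw [b.star_finsetProj, b.finsetProj_mul_self] at h
  nlinarith [norm_nonneg (b.finsetProj F)]

omit [CompleteSpace H] in
theorem HilbertBasis.tendsto_finsetProj_apply (x : H) :
    Tendsto (fun F => b.finsetProj F x) atTop (𝓝 x) := by
  have h := b.hasSum_repr x
  simpa [HasSum, finsetProj, sum_apply, b.repr_apply_apply] using h

/-- Strong convergence of contractions is uniform on totally bounded sets, such as the image of the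
unit ball under a compact operator. -/
theorem HilbertBasis.tendsto_finsetProj_mul {T : H →L[ℂ] H} (hT : IsCompactOperator T) :
    Tendsto (fun F => b.finsetProj F * T) atTop (𝓝 T) := by
  rw [Metric.tendsto_nhds]
  intro ε hε
  have hK := ((IsCompactOperator.isCompact_closure_image_closedBall
    (f := (T : H →ₗ[ℂ] H)) hT 1).totallyBounded.subset subset_closure)
  obtain ⟨t, htK, htf, ht⟩ := Metric.finite_approx_of_totallyBounded hK (ε / 8) (by positivity)
  have hev : ∀ᶠ F in atTop, ∀ y ∈ t, ‖b.finsetProj F y - y‖ < ε / 4 := by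
    rw [htf.eventually_all]
    intro y _
    simpa [dist_eq_norm] using
      (Metric.tendsto_nhds.mp (b.tendsto_finsetProj_apply y)) (ε / 4) (by positivity)
  filter_upwards [hev] with F hF
  rw [dist_eq_norm]
  -- With `y` from the finite net, the three terms contribute `ε / 8 + ε / 4 + ε / 8`.
  refine lt_of_le_of_lt (ContinuousLinearMap.opNorm_le_of_unit_norm (C := ε / 2) (by positivity)
    fun x hx => ?_) (by linarith)
  obtain ⟨y, hy, hxy⟩ : ∃ y ∈ t, dist (T x) y < ε / 8 := by
    simpa using ht ⟨x, by simpa using hx.le, rfl⟩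
  rw [dist_eq_norm] at hxy
  have e : (b.finsetProj F * T - T) x
      = b.finsetProj F (T x - y) + (b.finsetProj F y - y) - (T x - y) := by
    rw [map_sub]; change b.finsetProj F (T x) - T x = _; abel
  have h1 : ‖b.finsetProj F (T x - y)‖ ≤ ‖T x - y‖ := by
    simpa using (b.finsetProj F).le_of_opNorm_le (b.norm_finsetProj_le F) (T x - y)
  rw [e]
  have h2 := norm_sub_le (b.finsetProj F (T x - y) + (b.finsetProj F y - y)) (T x - y)
  have h3 := norm_add_le (b.finsetProj F (T x - y)) (b.finsetProj F y - y)
  linarith [hF y hy]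

/-- The matrix units of a Hilbert basis span a dense subspace of the compact operators. -/
theorem HilbertBasis.dense_span_compactRankOne :
    Dense (Submodule.span ℂ
      (Set.range fun p : I × I => compactRankOne (b p.1) (b p.2)) : Set (compactOperators H)) := by
  set S := Submodule.span ℂ (Set.range fun p : I × I => compactRankOne (b p.1) (b p.2))
  have step : ∀ k : compactOperators H, (∀ F, ∃ s ∈ S, (s : H →L[ℂ] H) = b.finsetProj F * k) →
      k ∈ S.topologicalClosure := by
    intro k hk
    choose s hs hsk using hk
    refine mem_closure_of_tendsto (f := s) (b := atTop) ?_ (.of_forall hs)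
    rw [tendsto_subtype_rng]
    simpa only [hsk] using b.tendsto_finsetProj_mul k.2
  intro k
  change k ∈ S.topologicalClosure
  have hx : ∀ x i, compactRankOne x (b i) ∈ S.topologicalClosure := by
    intro x i
    refine step _ fun F => ⟨∑ j ∈ F, inner ℂ (b j) x • compactRankOne (b j) (b i),
      S.sum_mem fun j _ => S.smul_mem _ (Submodule.subset_span ⟨(j, i), rfl⟩), ?_⟩
    simp only [HilbertBasis.finsetProj, Finset.sum_mul, AddSubmonoidClass.coe_finsetSum]
    refine Finset.sum_congr rfl fun j _ => ?_
    exact (rankOne_comp_rankOne _ _ _ _).symm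
  -- Truncation on the right: `k * b.finsetProj F` is this sum of rank one operators, and it
  -- converges by taking adjoints in the left truncation of `star k`.
  have hlim : Tendsto (fun F => ∑ i ∈ F, compactRankOne (k.1 (b i)) (b i)) atTop (𝓝 k) := by
    rw [tendsto_subtype_rng]
    have h := (continuous_star.tendsto _).comp (b.tendsto_finsetProj_mul (star k).2)
    have e : star ((star k : compactOperators H) : H →L[ℂ] H) = k := star_star (k : H →L[ℂ] H)
    rw [e] at h
    refine h.congr fun F => ?_
    rw [Function.comp_apply, star_mul, e, b.star_finsetProj, HilbertBasis.finsetProj,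
      Finset.mul_sum, AddSubmonoidClass.coe_finsetSum]
    exact Finset.sum_congr rfl fun i _ => InnerProductSpace.comp_rankOne _ _ _
  exact S.isClosed_topologicalClosure.mem_of_tendsto hlim
    (.of_forall fun F => Submodule.sum_mem _ fun i _ => hx _ i)

end Compact

/-! ### Uniqueness of the C⋆-seminorm on a tensor product with matrix units -/

section TensorMaps

variable {C D X Y : Type*} [NonUnitalCStarAlgebra C] [NonUnitalCStarAlgebra D]
  [NonUnitalCStarAlgebra X] [NonUnitalCStarAlgebra Y]

/-- A star homomorphism on the algebraic tensor product, continuous in the second variable. -/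
structure IsStarTensorMap (f : C ⊗[ℂ] D →ₗ[ℂ] X) : Prop where
  map_mul : ∀ x y, f (x * y) = f x * f y
  map_star : ∀ x, f (star x) = star (f x)
  continuous_right : ∀ c, Continuous fun d => f (c ⊗ₜ d)

theorem IsStarTensorMap.continuous_norm_sum {f : C ⊗[ℂ] D →ₗ[ℂ] X} (hf : IsStarTensorMap f)
    {N : Type*} [Fintype N] (c : N → C) :
    Continuous fun d : N → D => ‖f (∑ i, c i ⊗ₜ d i)‖ := by
  simp only [map_sum]
  exact (continuous_finsetSum _ fun i _ =>
    (hf.continuous_right (c i)).comp (continuous_apply i)).norm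

variable {n I : Type*} [Fintype n]

/-- The element `∑ M i j ⊗ E i j` of the algebraic tensor product. -/
noncomputable def matrixTensor (E : n → n → D) (M : n → n → C) : C ⊗[ℂ] D :=
  ∑ i, ∑ j, M i j ⊗ₜ[ℂ] E i j

theorem IsMatrixUnits.matrixTensor_mul {E : n → n → D} (hE : IsMatrixUnits E) (M N : n → n → C) :
    matrixTensor E M * matrixTensor E N
      = matrixTensor E fun i j => ∑ k, M i k * N k j := by
  simp only [matrixTensor, Finset.sum_mul, Finset.mul_sum, TensorProduct.sum_tmul,
    Algebra.TensorProduct.tmul_mul_tmul]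
  have h : ∀ k l i, ∑ j, (M i j * N k l) ⊗ₜ[ℂ] (E i j * E k l)
      = (M i k * N k l) ⊗ₜ[ℂ] E i l := fun k l i => by
    rw [Finset.sum_eq_single_of_mem k (Finset.mem_univ k), hE.mul_same]
    exact fun j _ hj => by rw [hE.mul_of_ne _ _ hj, TensorProduct.tmul_zero]
  simp only [h]
  calc _ = ∑ k, ∑ i, ∑ l, (M i k * N k l) ⊗ₜ[ℂ] E i l :=
        Finset.sum_congr rfl fun _ _ => Finset.sum_comm
    _ = ∑ i, ∑ k, ∑ l, (M i k * N k l) ⊗ₜ[ℂ] E i l := Finset.sum_comm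
    _ = _ := Finset.sum_congr rfl fun _ _ => Finset.sum_comm

theorem IsMatrixUnits.star_matrixTensor {E : n → n → D} (hE : IsMatrixUnits E)
    (M : n → n → C) :
    star (matrixTensor E M) = matrixTensor E fun i j => star (M j i) := by
  simp only [matrixTensor, star_sum, TensorProduct.star_tmul, hE.star_apply]
  exact Finset.sum_comm

/-- The star homomorphism on matrices over `C` given by a star homomorphism on `C ⊗ D` and a finite
system of matrix units in `D`. -/
noncomputable def IsStarTensorMap.matrixHom {f : C ⊗[ℂ] D →ₗ[ℂ] X} (hf : IsStarTensorMap f)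
    {E : n → n → D} (hE : IsMatrixUnits E) : CStarMatrix n n C →⋆ₙₐ[ℂ] X where
  toFun M := f (matrixTensor E M)
  map_smul' c M := by
    simp only [matrixTensor, CStarMatrix.smul_apply, ← TensorProduct.smul_tmul',
      ← Finset.smul_sum, map_smul, MonoidHom.id_apply]
  map_zero' := by simp [matrixTensor]
  map_add' M N := by
    simp only [matrixTensor, CStarMatrix.add_apply, TensorProduct.add_tmul,
      Finset.sum_add_distrib, map_add]
  map_mul' M N := (congrArg f (hE.matrixTensor_mul M N).symm).trans (hf.map_mul _ _)
  map_star' M := (congrArg f (hE.star_matrixTensor M).symm).trans (hf.map_star _)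

/-- Multiplying by `c ⊗ E p p` on the left and `d ⊗ E q q` on the right isolates the entry at `(p,
q)`. As `C` may lack a unit, `c` and `d` stay arbitrary; taking both to be the adjoint of the entry
then makes it vanish. -/
theorem IsStarTensorMap.matrixHom_injective {f : C ⊗[ℂ] D →ₗ[ℂ] X} (hf : IsStarTensorMap f)
    {E : n → n → D} (hE : IsMatrixUnits E) (h0 : ∀ c i j, f (c ⊗ₜ E i j) = 0 → c = 0) :
    Function.Injective (hf.matrixHom hE) := by
  rw [injective_iff_map_eq_zero]
  intro M hM
  change f (matrixTensor E M) = 0 at hM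
  ext p q
  have key : ∀ c d : C, c * M p q * d = 0 := by
    intro c d
    apply h0 _ p q
    have e : (c ⊗ₜ[ℂ] E p p) * matrixTensor E M * (d ⊗ₜ[ℂ] E q q)
        = (c * M p q * d) ⊗ₜ[ℂ] E p q := by
      simp only [matrixTensor, Finset.mul_sum, Finset.sum_mul,
        Algebra.TensorProduct.tmul_mul_tmul]
      rw [Finset.sum_eq_single_of_mem p (Finset.mem_univ p),
        Finset.sum_eq_single_of_mem q (Finset.mem_univ q), hE.mul_same, hE.mul_same]
      · intro j _ hj
        rw [hE.mul_same, hE.mul_of_ne _ _ hj, TensorProduct.tmul_zero]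
      · intro i _ hi
        refine Finset.sum_eq_zero fun j _ => ?_
        rw [hE.mul_of_ne _ _ hi.symm, zero_mul, TensorProduct.tmul_zero]
    rw [← e, hf.map_mul, hf.map_mul, hM, mul_zero, zero_mul]
  have h1 : ∀ d, M p q * d = 0 := fun d => by
    rw [← CStarRing.star_mul_self_eq_zero_iff, star_mul, mul_assoc, ← mul_assoc _ (M p q) d, key,
      mul_zero]
  exact (CStarRing.mul_star_self_eq_zero_iff _).mp (h1 _)

theorem IsMatrixUnits.comp {E : I → I → D} (hE : IsMatrixUnits E) {J : Type*} {s : J → I}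
    (hs : Function.Injective s) : IsMatrixUnits fun i j => E (s i) (s j) where
  mul_same _ _ _ := hE.mul_same _ _ _
  mul_of_ne _ _ _ _ h := hE.mul_of_ne _ _ (hs.ne h)
  star_apply _ _ := hE.star_apply _ _
  ne_zero _ _ := hE.ne_zero _ _

-- The matrix `M` does not depend on `F`, so finitely many tensors can be expanded over one common
-- `F`.
open Filter in
theorem exists_eventually_eq_matrixTensor {E : I → I → D} (c : C) {d : D}
    (hd : d ∈ Submodule.span ℂ (Set.range fun p : I × I => E p.1 p.2)) :
    ∃ M : I → I → C, ∀ᶠ F : Finset I in atTop,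
      c ⊗ₜ[ℂ] d = matrixTensor (fun i j : F => E i j) fun i j => M i j := by
  classical
  induction hd using Submodule.span_induction with
  | mem d hd =>
    obtain ⟨⟨p, q⟩, rfl⟩ := hd
    refine ⟨fun i j => if i = p ∧ j = q then c else 0, ?_⟩
    filter_upwards [eventually_ge_atTop {p, q}] with F hF
    have hp : p ∈ F := hF (by simp)
    have hq : q ∈ F := hF (by simp)
    rw [matrixTensor, Finset.sum_eq_single_of_mem ⟨p, hp⟩ (Finset.mem_univ _),
      Finset.sum_eq_single_of_mem ⟨q, hq⟩ (Finset.mem_univ _)]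
    · simp
    · intro j _ hj
      rw [if_neg fun h => hj (Subtype.ext h.2), TensorProduct.zero_tmul]
    · intro i _ hi
      refine Finset.sum_eq_zero fun j _ => ?_
      rw [if_neg fun h => hi (Subtype.ext h.1), TensorProduct.zero_tmul]
  | zero => exact ⟨0, .of_forall fun F => by simp [matrixTensor]⟩
  | add x y _ _ hx hy =>
    obtain ⟨M, hM⟩ := hx
    obtain ⟨N, hN⟩ := hy
    refine ⟨M + N, ?_⟩
    filter_upwards [hM, hN] with F hMF hNF
    rw [TensorProduct.tmul_add, hMF, hNF]
    simp only [matrixTensor, Pi.add_apply, TensorProduct.add_tmul, Finset.sum_add_distrib]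
  | smul a x _ hx =>
    obtain ⟨M, hM⟩ := hx
    refine ⟨a • M, ?_⟩
    filter_upwards [hM] with F hMF
    rw [TensorProduct.tmul_smul, hMF]
    simp only [matrixTensor, Pi.smul_apply, ← TensorProduct.smul_tmul', Finset.smul_sum]

/-- Let `D` be densely spanned by matrix units. Then all star homomorphisms on `C ⊗ D` which are
injective on the matrix entries induce the same seminorm. -/
theorem IsMatrixUnits.norm_map_eq {E : I → I → D} (hE : IsMatrixUnits E)
    (hdense : Dense (Submodule.span ℂ (Set.range fun p : I × I => E p.1 p.2) : Set D))
    {f : C ⊗[ℂ] D →ₗ[ℂ] X} (hf : IsStarTensorMap f) (hf0 : ∀ c i j, f (c ⊗ₜ E i j) = 0 → c = 0)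
    {g : C ⊗[ℂ] D →ₗ[ℂ] Y} (hg : IsStarTensorMap g) (hg0 : ∀ c i j, g (c ⊗ₜ E i j) = 0 → c = 0)
    (x : C ⊗[ℂ] D) : ‖f x‖ = ‖g x‖ := by
  -- The order serves only to make the matrices over `C` a C⋆-algebra.
  let := CStarAlgebra.spectralOrder C
  have := CStarAlgebra.spectralOrderedRing C
  obtain ⟨N, c, d, rfl⟩ : ∃ (N : Finset (C × D)) (c : N → C) (d : N → D),
      x = ∑ i, c i ⊗ₜ d i := by
    obtain ⟨N, rfl⟩ := TensorProduct.exists_finset x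
    exact ⟨N, fun i => i.1.1, fun i => i.1.2, (Finset.sum_coe_sort N fun i => i.1 ⊗ₜ i.2).symm⟩
  -- With the `c i` fixed, both norms are continuous in the tuple `d`, so each `d i` may be taken in
  -- the span of the matrix units.
  have hd := dense_pi (Set.univ : Set (N)) fun _ _ => hdense
  refine congrFun (Continuous.ext_on hd (hf.continuous_norm_sum c)
    (hg.continuous_norm_sum c) fun d hd => ?_) d
  choose M hM using fun i =>
    exists_eventually_eq_matrixTensor (E := E) (c i) (hd i (Set.mem_univ i))
  obtain ⟨F, hF⟩ := (Filter.eventually_all.mpr hM).exists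
  have hEF := hE.comp (Subtype.val_injective (p := (· ∈ F)))
  have e : ∑ i, c i ⊗ₜ d i
      = matrixTensor (fun i j : F => E i j) (∑ i, fun k l : F => M i k l) := by
    simp only [hF, matrixTensor, Finset.sum_apply, TensorProduct.sum_tmul]
    rw [Finset.sum_comm]
    exact Finset.sum_congr rfl fun i _ => Finset.sum_comm
  simp only [e]
  -- Both maps are injective star homomorphisms on the same matrix algebra, so both preserve its
  -- norm.
  exact (NonUnitalStarAlgHom.norm_map (hf.matrixHom hEF)
      (hf.matrixHom_injective hEF fun c i j => hf0 c i j) _).trans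
    (NonUnitalStarAlgHom.norm_map (hg.matrixHom hEF)
      (hg.matrixHom_injective hEF fun c i j => hg0 c i j) _).symm

end TensorMaps

/-! ### Arguments by dense spans -/

section DenseSpan

variable {𝕜 𝕜' V W : Type*} [NontriviallyNormedField 𝕜] [NormedField 𝕜'] {σ : 𝕜 →+* 𝕜'}
  [NormedAddCommGroup V] [NormedSpace 𝕜 V] [NormedAddCommGroup W] [NormedSpace 𝕜' W]

/-- Semilinearity lets this apply to the star operation. The choice `U = ⊥` proves identities, and a
closed range as `U` proves membership. -/
theorem ContinuousLinearMap.mem_of_dense_span (g : V →SL[σ] W) {S : Set V}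
    (hS : Dense (Submodule.span 𝕜 S : Set V)) {U : Submodule 𝕜' W} (hU : IsClosed (U : Set W))
    (h : ∀ s ∈ S, g s ∈ U) (x : V) : g x ∈ U := by
  refine hS.induction (P := fun x => g x ∈ U) (fun y hy => ?_)
    (hU.preimage g.continuous) x
  induction hy using Submodule.span_induction with
  | mem y hy => exact h y hy
  | zero => rw [map_zero]; exact U.zero_mem
  | add y z _ _ hy hz => rw [map_add]; exact U.add_mem hy hz
  | smul a y _ hy => rw [map_smulₛₗ]; exact U.smul_mem _ hy

open Filter Topology in
/-- A bounded net of operators which converges on a set with dense span converges strongly. -/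
theorem ContinuousLinearMap.exists_tendsto_of_dense_span {V W : Type*} [NormedAddCommGroup V]
    [NormedSpace 𝕜 V] [NormedAddCommGroup W] [NormedSpace 𝕜 W] [CompleteSpace W] {α : Type*}
    {l : Filter α} [l.NeBot] {T : α → V →L[𝕜] W} {K : ℝ} (hK : ∀ i, ‖T i‖ ≤ K) {S : Set V}
    (hS : Dense (Submodule.span 𝕜 S : Set V))
    (hT : ∀ s ∈ S, ∃ y, Tendsto (fun i => T i s) l (𝓝 y)) :
    ∃ L : V →L[𝕜] W, ∀ x, Tendsto (fun i => T i x) l (𝓝 (L x)) := by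
  have hK0 : 0 ≤ K := by
    obtain ⟨i⟩ := l.nonempty_of_neBot
    exact (norm_nonneg _).trans (hK i)
  have hspan : ∀ x ∈ Submodule.span 𝕜 S, ∃ y, Tendsto (fun i => T i x) l (𝓝 y) := by
    intro x hx
    induction hx using Submodule.span_induction with
    | mem y hy => exact hT y hy
    | zero => exact ⟨0, by simp⟩
    | add y z _ _ hy hz =>
      obtain ⟨y', hy⟩ := hy
      obtain ⟨z', hz⟩ := hz
      exact ⟨y' + z', by simpa using hy.add hz⟩
    | smul a y _ hy =>
      obtain ⟨y', hy⟩ := hy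
      exact ⟨a • y', by simpa using hy.const_smul a⟩
  have hall : ∀ x, ∃ y, Tendsto (fun i => T i x) l (𝓝 y) := by
    intro x
    refine cauchy_map_iff_exists_tendsto.mp (Metric.cauchy_iff.mpr ⟨inferInstance, fun ε hε => ?_⟩)
    -- Since `‖T i‖ ≤ K`, this distance gives `‖T i x - T i z‖ ≤ ε / 4` for every `i`; `K + 1`
    -- allows for `K = 0`.
    obtain ⟨z, hz, hxz⟩ := hS.exists_dist_lt x (ε := ε / (4 * (K + 1))) (by positivity)
    obtain ⟨y, hy⟩ := hspan z hz
    refine ⟨Metric.ball y (ε / 2), ?_, fun a ha b hb => ?_⟩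
    · rw [Filter.mem_map]
      filter_upwards [Metric.tendsto_nhds.mp hy (ε / 4) (by positivity)] with i hi
      rw [Set.mem_preimage, Metric.mem_ball]
      have h1 : dist (T i x) (T i z) ≤ ε / 4 := by
        rw [dist_eq_norm, ← map_sub]
        rw [dist_eq_norm, lt_div_iff₀ (by positivity)] at hxz
        have := (T i).le_of_opNorm_le (hK i) (x - z)
        nlinarith [norm_nonneg (x - z)]
      linarith [dist_triangle (T i x) (T i z) y]
    · rw [Metric.mem_ball] at ha hb
      linarith [dist_triangle_right a b y]
  choose L hL using hall
  refine ⟨LinearMap.mkContinuous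
    { toFun := L
      map_add' x y := tendsto_nhds_unique (hL _) (by simpa using (hL x).add (hL y))
      map_smul' a x := tendsto_nhds_unique (hL _) (by simpa using (hL x).const_smul a) } K
    fun x => le_of_tendsto (hL x).norm (.of_forall fun i => (T i).le_of_opNorm_le (hK i) x), hL⟩

end DenseSpan

/-! ### Strict limits of multipliers and amplification of corners -/

section Multiplier

variable {A : Type u} [NonUnitalCStarAlgebra A]

open Filter Topology in
/-- A bounded net of multipliers converges strictly, if it does so on a set with dense span. -/
theorem DoubleCentralizer.exists_strict_limit {α : Type*} {l : Filter α} [l.NeBot]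
    {m : α → 𝓜(ℂ, A)} {K : ℝ} (hK : ∀ i, ‖m i‖ ≤ K)
    {S : Set A} (hS : Dense (Submodule.span ℂ S : Set A))
    (hmS : ∀ s ∈ S, ∃ y, Tendsto (fun i => (m i).fst s) l (𝓝 y))
    {S' : Set A} (hS' : Dense (Submodule.span ℂ S' : Set A))
    (hmS' : ∀ s ∈ S', ∃ y, Tendsto (fun i => (m i).snd s) l (𝓝 y)) :
    ∃ n : 𝓜(ℂ, A), (∀ x, Tendsto (fun i => (m i).fst x) l (𝓝 (n.fst x))) ∧
      ∀ x, Tendsto (fun i => (m i).snd x) l (𝓝 (n.snd x)) := by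
  obtain ⟨L, hL⟩ := ContinuousLinearMap.exists_tendsto_of_dense_span
    (T := fun i => (m i).fst) (fun i => (norm_fst (m i)).trans_le (hK i)) hS hmS
  obtain ⟨R, hR⟩ := ContinuousLinearMap.exists_tendsto_of_dense_span
    (T := fun i => (m i).snd) (fun i => (norm_snd (m i)).trans_le (hK i)) hS' hmS'
  exact ⟨⟨(L, R), fun x y => tendsto_nhds_unique ((hR x).mul_const y)
    (((hL y).const_mul x).congr fun i => ((m i).central x y).symm)⟩, hL, hR⟩

/-- The corner of a C⋆-algebra cut out by a self-adjoint element. -/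
def cornerSubalgebra {B : Type*} [NonUnitalCStarAlgebra B] (e : B) (he : star e = e) :
    NonUnitalStarSubalgebra ℂ B where
  carrier := {c | e * c = c ∧ c * e = c}
  zero_mem' := by simp
  add_mem' hx hy := ⟨by rw [mul_add, hx.1, hy.1], by rw [add_mul, hx.2, hy.2]⟩
  smul_mem' a x hx := ⟨by rw [mul_smul_comm, hx.1], by rw [smul_mul_assoc, hx.2]⟩
  mul_mem' hx hy := ⟨by rw [← mul_assoc, hx.1], by rw [mul_assoc, hy.2]⟩
  star_mem' {x} hx := ⟨by nth_rw 1 [← he, ← star_mul, hx.2], by nth_rw 1 [← he, ← star_mul, hx.1]⟩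

instance isClosed_cornerSubalgebra {B : Type*} [NonUnitalCStarAlgebra B] (e : B)
    (he : star e = e) : IsClosed (cornerSubalgebra e he : Set B) :=
  (isClosed_eq (continuous_const_mul e) continuous_id).inter
    (isClosed_eq (continuous_mul_const e) continuous_id)

/-- The amplification `c ↦ ∑ v p * c * star (v p)` of a corner along partial isometries with
orthogonal ranges is contractive. -/
theorem norm_sum_mul_mul_star_le {B J : Type*} [NonUnitalCStarAlgebra B] {e : B} (he : star e = e)
    {v : J → B} (hv : ∀ p, star (v p) * v p = e) (hv' : ∀ p q, p ≠ q → star (v p) * v q = 0)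
    {c : B} (hc : c ∈ cornerSubalgebra e he) (F : Finset J) :
    ‖∑ p ∈ F, v p * c * star (v p)‖ ≤ ‖c‖ := by
  -- Cross terms of a product vanish by orthogonality of the ranges, and `star (v p) * v p = e` is a
  -- unit for the corner, so this is a star homomorphism and therefore contractive.
  let T : cornerSubalgebra e he →⋆ₙₐ[ℂ] B :=
    { toFun c := ∑ p ∈ F, v p * c * star (v p)
      map_smul' a c := by
        simp [mul_smul_comm, smul_mul_assoc, Finset.smul_sum]
      map_zero' := by simp
      map_add' c d := by simp [mul_add, add_mul, Finset.sum_add_distrib]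
      map_mul' c d := by
        rw [Finset.sum_mul_sum]
        refine Finset.sum_congr rfl fun p hp => ?_
        rw [Finset.sum_eq_single_of_mem p hp]
        · obtain ⟨c, hc⟩ := c
          have h : c * e = c := hc.2
          change v p * (c * d) * star (v p) = v p * c * star (v p) * (v p * d * star (v p))
          calc v p * (c * d) * star (v p) = v p * (c * e * d) * star (v p) := by rw [h]
            _ = _ := by simp only [← hv p, mul_assoc]
        · intro q _ hq
          have h := hv' p q hq.symm
          calc v p * c * star (v p) * (v q * d * star (v q))
              = v p * c * (star (v p) * v q) * d * star (v q) := by simp only [mul_assoc]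
            _ = 0 := by rw [h]; simp
      map_star' c := by
        rw [star_sum]
        exact Finset.sum_congr rfl fun p _ => by simp [mul_assoc] }
  exact NonUnitalStarAlgHom.norm_apply_le T ⟨c, hc⟩

end Multiplier

/-! ### Nondegeneracy and construction of elements of the relative commutant -/

section Commutant

open Filter Topology

variable {A : Type u} [NonUnitalCStarAlgebra A] {D : Type v} [NonUnitalCStarAlgebra D]
  {ι : D →⋆ₙₐ[ℂ] 𝓜(ℂ, A)} {I : Type*} {E : I → I → D}

/-- Centrality gives the equality of left parts after multiplication by any `y` on the left; taking
`y` to be the adjoint of the difference removes this factor. -/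
theorem DoubleCentralizer.mul_coe (m : 𝓜(ℂ, A)) (a : A) : m * a = (m.fst a : A) := by
  ext x
  · change m.fst (a * x) = m.fst a * x
    have key : ∀ y : A, y * (m.fst (a * x)) = y * (m.fst a * x) := fun y => by
      rw [← mul_assoc, ← m.central, ← m.central, mul_assoc]
    rw [← sub_eq_zero, ← CStarRing.star_mul_self_eq_zero_iff, mul_sub, key, sub_self]
  · exact m.central x a

theorem DoubleCentralizer.coe_mul (m : 𝓜(ℂ, A)) (a : A) : a * m = (m.snd a : A) := by
  ext x
  · exact (m.central a x).symm
  · change m.snd (x * a) = x * m.snd a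
    have key : ∀ y : A, m.snd (x * a) * y = (x * m.snd a) * y := fun y => by
      rw [m.central, mul_assoc, ← m.central, mul_assoc]
    rw [← sub_eq_zero, ← CStarRing.mul_star_self_eq_zero_iff, sub_mul, key, sub_self]

variable (A) in
/-- The embedding of `A` in `M(A)` as a continuous linear map. -/
noncomputable def coeMultiplierL : A →L[ℂ] 𝓜(ℂ, A) :=
  ⟨{  toFun := DoubleCentralizer.coe ℂ
      map_add' := map_add (DoubleCentralizer.coeHom (𝕜 := ℂ) (A := A))
      map_smul' := map_smul (DoubleCentralizer.coeHom (𝕜 := ℂ) (A := A)) },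
    isometry_coeMultiplier.continuous⟩

/-- For fixed `a` the map `d ↦ ι(d) a` is continuous, so matrix units suffice in the definition of
nondegeneracy. -/
theorem IsNondegenerate.dense_fst (hι : IsNondegenerate ι)
    (hE : Dense (Submodule.span ℂ (Set.range fun p : I × I => E p.1 p.2) : Set D)) :
    Dense (Submodule.span ℂ {x : A | ∃ i j a, (ι (E i j)).fst a = x} : Set A) := by
  set U := (Submodule.span ℂ {x : A | ∃ i j a, (ι (E i j)).fst a = x}).topologicalClosure
  intro x
  change x ∈ U
  refine (ContinuousLinearMap.id ℂ A).mem_of_dense_span hι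
    (Submodule.isClosed_topologicalClosure _) ?_ x
  rintro _ ⟨d, a, rfl⟩
  let g : D →L[ℂ] A := LinearMap.mkContinuous
    { toFun d := (ι d).fst a
      map_add' x y := by rw [map_add]; rfl
      map_smul' c x := by rw [map_smul]; rfl } ‖a‖ fun d => by
    refine ((ι d).fst.le_opNorm a).trans ?_
    rw [DoubleCentralizer.norm_fst, mul_comm]
    exact mul_le_mul_of_nonneg_left (NonUnitalStarAlgHom.norm_apply_le ι d) (norm_nonneg a)
  refine g.mem_of_dense_span hE (Submodule.isClosed_topologicalClosure _) ?_ d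
  rintro _ ⟨p, rfl⟩
  exact Submodule.le_topologicalClosure _ (Submodule.subset_span ⟨p.1, p.2, a, rfl⟩)

theorem IsNondegenerate.dense_snd (hι : IsNondegenerate ι) (hE : IsMatrixUnits E)
    (hdense : Dense (Submodule.span ℂ (Set.range fun p : I × I => E p.1 p.2) : Set D)) :
    Dense (Submodule.span ℂ {x : A | ∃ i j a, (ι (E i j)).snd a = x} : Set A) := by
  intro x
  have h := ((starₗᵢ ℂ : A ≃ₗᵢ⋆[ℂ] A) : A →L⋆[ℂ] A).mem_of_dense_span (hι.dense_fst hdense)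
    (U := (Submodule.span ℂ {x : A | ∃ i j a, (ι (E i j)).snd a = x}).topologicalClosure)
    (Submodule.isClosed_topologicalClosure _) ?_ (star x)
  · change star (star x) ∈ _ at h
    rwa [star_star] at h
  · rintro _ ⟨i, j, a, rfl⟩
    refine Submodule.le_topologicalClosure _ (Submodule.subset_span ⟨j, i, star a, ?_⟩)
    rw [← hE.star_apply i j, map_star ι, DoubleCentralizer.star_snd, star_star]
    rfl

/-- The one-sided densities are combined. The elements `ι (E i j) a ι (E k l)` are those later
exhibited in the range of the isomorphism. -/
theorem IsNondegenerate.dense_fst_snd (hι : IsNondegenerate ι) (hE : IsMatrixUnits E)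
    (hdense : Dense (Submodule.span ℂ (Set.range fun p : I × I => E p.1 p.2) : Set D)) :
    Dense (Submodule.span ℂ
      {x : A | ∃ i j k l a, (ι (E i j)).fst ((ι (E k l)).snd a) = x} : Set A) := by
  intro x
  refine (ContinuousLinearMap.id ℂ A).mem_of_dense_span (hι.dense_fst hdense)
    (Submodule.isClosed_topologicalClosure _) ?_ x
  rintro _ ⟨i, j, a, rfl⟩
  refine (ι (E i j)).fst.mem_of_dense_span (hι.dense_snd hE hdense)
    (Submodule.isClosed_topologicalClosure _) ?_ a
  rintro _ ⟨k, l, a, rfl⟩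
  exact Submodule.le_topologicalClosure _ (Submodule.subset_span ⟨i, j, k, l, a, rfl⟩)

/-- The strict sum `m = ∑ p, ι(E p i) a ι(E j p)` lies in the relative commutant, and
`m ι(E q r) = ι(E q i) a ι(E j r)`. -/
theorem IsNondegenerate.exists_mem_relativeCommutant (hι : IsNondegenerate ι)
    (hE : IsMatrixUnits E)
    (hdense : Dense (Submodule.span ℂ (Set.range fun p : I × I => E p.1 p.2) : Set D))
    (a : A) (i j : I) :
    ∃ m ∈ relativeCommutant ι, ∀ q r, m * ι (E q r) = ι (E q i) * a * ι (E j r) := by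
  classical
  set s : Finset I → 𝓜(ℂ, A) := fun F => ∑ p ∈ F, ι (E p i) * a * ι (E j p) with hs
  -- Only the term `p = q` survives, so the net is eventually constant on the dense span; no
  -- convergence estimate is needed there.
  have hsl : ∀ (F : Finset I) q r, q ∈ F → s F * ι (E q r) = ι (E q i) * a * ι (E j r) := by
    intro F q r hq
    rw [hs, Finset.sum_mul, Finset.sum_eq_single_of_mem q hq, mul_assoc, ← map_mul, hE.mul_same]
    intro p _ hp
    rw [mul_assoc, ← map_mul, hE.mul_of_ne _ _ hp, map_zero, mul_zero]
  have hsr : ∀ (F : Finset I) q r, r ∈ F → ι (E q r) * s F = ι (E q i) * a * ι (E j r) := by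
    intro F q r hr
    rw [hs, Finset.mul_sum, Finset.sum_eq_single_of_mem r hr, ← mul_assoc, ← mul_assoc, ← map_mul,
      hE.mul_same]
    intro p _ hp
    rw [← mul_assoc, ← mul_assoc, ← map_mul, hE.mul_of_ne _ _ hp.symm, map_zero, zero_mul, zero_mul]
  have he : star (ι (E i i)) = ι (E i i) := by rw [← map_star, hE.star_apply]
  -- Moving `a` into the corner at `i` makes the summand at `p` equal to `v p * c * star (v p)` with
  -- `v p = ι (E p i)`, which bounds `s F` uniformly in `F`.
  set c : 𝓜(ℂ, A) := ι (E i i) * a * ι (E j i) with hc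
  have hcorner : c ∈ cornerSubalgebra _ he := by
    constructor
    · rw [hc, ← mul_assoc, ← mul_assoc, ← map_mul, hE.mul_same]
    · rw [hc, mul_assoc, ← map_mul, hE.mul_same]
  have hbound : ∀ F, ‖s F‖ ≤ ‖c‖ := by
    intro F
    have h := norm_sum_mul_mul_star_le he (v := fun p => ι (E p i))
      (fun p => by rw [← map_star, hE.star_apply, ← map_mul, hE.mul_same])
      (fun p q hpq => by
        rw [← map_star, hE.star_apply, ← map_mul, hE.mul_of_ne _ _ hpq, map_zero]) hcorner F
    refine (congrArg norm (Finset.sum_congr rfl fun p _ => ?_)).trans_le h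
    rw [← map_star, hE.star_apply, hc, ← mul_assoc, ← mul_assoc, ← map_mul, hE.mul_same,
      mul_assoc _ (ι (E j i)), ← map_mul, hE.mul_same]
  obtain ⟨m, hm, hm'⟩ := DoubleCentralizer.exists_strict_limit (l := atTop) hbound
    (hι.dense_fst hdense)
    (by
      rintro _ ⟨q, r, x, rfl⟩
      refine ⟨(ι (E q i) * a * ι (E j r)).fst x, tendsto_const_nhds.congr' ?_⟩
      filter_upwards [eventually_ge_atTop {q}] with F hF
      rw [← hsl F q r (hF (Finset.mem_singleton_self q))]
      rfl)
    (hι.dense_snd hE hdense)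
    (by
      rintro _ ⟨q, r, x, rfl⟩
      refine ⟨(ι (E q i) * a * ι (E j r)).snd x, tendsto_const_nhds.congr' ?_⟩
      filter_upwards [eventually_ge_atTop {r}] with F hF
      rw [← hsr F q r (hF (Finset.mem_singleton_self r))]
      rfl)
  have hml : ∀ q r, m * ι (E q r) = ι (E q i) * a * ι (E j r) := by
    intro q r
    ext x
    · refine tendsto_nhds_unique (hm ((ι (E q r)).fst x)) (tendsto_const_nhds.congr' ?_)
      filter_upwards [eventually_ge_atTop {q}] with F hF
      rw [← hsl F q r (hF (Finset.mem_singleton_self q))]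
      rfl
    · refine tendsto_nhds_unique (((ι (E q r)).snd.continuous.tendsto _).comp (hm' x))
        (tendsto_const_nhds.congr' ?_)
      filter_upwards [eventually_ge_atTop {q}] with F hF
      rw [← hsl F q r (hF (Finset.mem_singleton_self q))]
      rfl
  have hmr : ∀ q r, ι (E q r) * m = ι (E q i) * a * ι (E j r) := by
    intro q r
    ext x
    · refine tendsto_nhds_unique (((ι (E q r)).fst.continuous.tendsto _).comp (hm x))
        (tendsto_const_nhds.congr' ?_)
      filter_upwards [eventually_ge_atTop {r}] with F hF
      rw [← hsr F q r (hF (Finset.mem_singleton_self r))]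
      rfl
    · refine tendsto_nhds_unique (hm' ((ι (E q r)).snd x)) (tendsto_const_nhds.congr' ?_)
      filter_upwards [eventually_ge_atTop {r}] with F hF
      rw [← hsr F q r (hF (Finset.mem_singleton_self r))]
      rfl
  refine ⟨m, fun d => ?_, hml⟩
  -- Commuting with `ι d` and mapping it into `A` are closed linear conditions on `d`, so they need
  -- checking only on matrix units.
  let g : D →L[ℂ] 𝓜(ℂ, A) := LinearMap.mkContinuous
    { toFun := ι, map_add' := map_add ι, map_smul' := map_smul ι } 1 fun d => by
    rw [one_mul]; exact NonUnitalStarAlgHom.norm_apply_le ι d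
  have hcomm := ((ContinuousLinearMap.mul ℂ 𝓜(ℂ, A) m) ∘L g
    - ((ContinuousLinearMap.mul ℂ 𝓜(ℂ, A)).flip m) ∘L g).mem_of_dense_span hdense (U := ⊥)
    isClosed_singleton (by
      rintro _ ⟨p, rfl⟩
      exact sub_eq_zero.mpr ((hml p.1 p.2).trans (hmr p.1 p.2).symm)) d
  have hmem := ((ContinuousLinearMap.mul ℂ 𝓜(ℂ, A) m) ∘L g).mem_of_dense_span hdense
    (U := LinearMap.range (coeMultiplierL A).toLinearMap)
    isometry_coeMultiplier.isClosedEmbedding.isClosed_range (by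
      rintro _ ⟨p, rfl⟩
      refine ⟨(ι (E p.1 i)).fst ((ι (E j p.2)).snd a), ?_⟩
      change DoubleCentralizer.coe ℂ _ = m * ι (E p.1 p.2)
      rw [hml, ← DoubleCentralizer.mul_coe, ← DoubleCentralizer.coe_mul, mul_assoc]) d
  exact ⟨sub_eq_zero.mp hcomm, hmem⟩

end Commutant

/-! ### Extension to the minimal tensor product -/

section Extension

open UniformSpace

variable {C : Type u} {D : Type v} [NonUnitalCStarAlgebra C] [NonUnitalCStarAlgebra D]

theorem MinTensor.isStarTensorMap_of :
    IsStarTensorMap (MinTensor.of : C ⊗[ℂ] D →ₗ[ℂ] MinTensor C D) where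
  map_mul := of_mul
  map_star := of_star
  continuous_right c := by
    refine AddMonoidHomClass.continuous_of_bound (MinTensor.of ∘ₗ TensorProduct.mk ℂ C D c) ‖c‖
      fun d => ?_
    refine (norm_of _).trans_le (minTensorNorm_le (by positivity) fun π ρ =>
      (π.norm_tensorOp_le ρ _ _).trans ?_)
    exact mul_le_mul (NonUnitalStarAlgHom.norm_apply_le π.hom c)
      (NonUnitalStarAlgHom.norm_apply_le ρ.hom d) (norm_nonneg _) (norm_nonneg _)

/-- A star homomorphism on `C ⊗ D` which is isometric for the minimal norm extends to an isometric
star homomorphism on the minimal tensor product. -/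
theorem MinTensor.exists_extension {X : Type*} [NonUnitalCStarAlgebra X]
    {f : C ⊗[ℂ] D →ₗ[ℂ] X} (hf : IsStarTensorMap f) (hnorm : ∀ x, ‖f x‖ = minTensorNorm x) :
    ∃ g : MinTensor C D →⋆ₙₐ[ℂ] X, Isometry g ∧ ∀ x, g (of x) = f x := by
  have hiso : Isometry (fun x : AlgMinTensor C D => f x) :=
    AddMonoidHomClass.isometry_of_norm
      (⟨⟨f, map_zero f⟩, map_add f⟩ : AlgMinTensor C D →+ X) hnorm
  let g : MinTensor C D → X := Completion.extension fun x : AlgMinTensor C D => f x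
  have hg : Isometry g := hiso.completion_extension
  have hgc : Continuous g := hg.continuous
  have hgof : ∀ x, g (of x) = f x := fun x =>
    Completion.extension_coe (α := AlgMinTensor C D) hiso.uniformContinuous x
  refine ⟨{ toFun := g, map_smul' := fun c x => ?_, map_zero' := ?_, map_add' := fun x y => ?_,
            map_mul' := fun x y => ?_, map_star' := fun x => ?_ }, hg, hgof⟩
  · exact denseRange_of.induction_on (p := fun x => g (c • x) = c • g x) x
      (isClosed_eq (hgc.comp (continuous_const_smul c)) (hgc.const_smul c))
      fun a => by rw [← map_smul, hgof, hgof, map_smul]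
  · rw [← map_zero of, hgof, map_zero]
  · exact denseRange_of.induction_on₂ (p := fun x y => g (x + y) = g x + g y)
      (isClosed_eq (by fun_prop) (by fun_prop))
      (fun a b => by rw [← map_add, hgof, hgof, hgof, map_add]) x y
  · exact denseRange_of.induction_on₂ (p := fun x y => g (x * y) = g x * g y)
      (isClosed_eq (by fun_prop) (by fun_prop))
      (fun a b => by rw [← of_mul, hgof, hgof, hgof, hf.map_mul]) x y
  · exact denseRange_of.induction_on (p := fun x => g (star x) = star (g x)) x
      (isClosed_eq (by fun_prop) (by fun_prop))
      fun a => by rw [← of_star, hgof, hgof, hf.map_star]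

/-- The equivalence is `j⁻¹ ∘ g`; each algebraic identity is checked after applying the injective
`j`. -/
theorem exists_starAlgEquiv_of_range_eq {X A M : Type*} [NonUnitalCStarAlgebra X]
    [NonUnitalCStarAlgebra A] [NonUnitalCStarAlgebra M] {g : X →⋆ₙₐ[ℂ] M} {j : A →⋆ₙₐ[ℂ] M}
    (hg : Function.Injective g) (hj : Function.Injective j) (h : Set.range g = Set.range j) :
    ∃ θ : X ≃⋆ₐ[ℂ] A, ∀ x, j (θ x) = g x := by
  let e : X ≃ A := (Equiv.ofInjective g hg).trans
    ((Equiv.setCongr h).trans (Equiv.ofInjective j hj).symm)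
  have he : ∀ x, j (e x) = g x := fun x =>
    congrArg Subtype.val ((Equiv.ofInjective j hj).apply_symm_apply _)
  exact ⟨{ e with
    map_mul' := fun x y => hj <| by
      change j (e (x * y)) = j (e x * e y)
      rw [he, map_mul, map_mul, he, he]
    map_add' := fun x y => hj <| by
      change j (e (x + y)) = j (e x + e y)
      rw [he, map_add, map_add, he, he]
    map_star' := fun x => hj <| by
      change j (e (star x)) = j (star (e x))
      rw [he, map_star, map_star, he]
    map_smul' := fun c x => hj <| by
      change j (e (c • x)) = j (c • e x)
      rw [he, map_smul, map_smul, he] }, he⟩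

end Extension

/-! ### The map `m ⊗ d ↦ m ι(d)` and the isomorphism -/

section Commutant

variable {A : Type u} [NonUnitalCStarAlgebra A] {D : Type v} [NonUnitalCStarAlgebra D]

/-- The homomorphism `m ⊗ d ↦ m ι(d)`. -/
noncomputable def commutantTensorMap (ι : D →⋆ₙₐ[ℂ] 𝓜(ℂ, A)) :
    relativeCommutant ι ⊗[ℂ] D →ₗ[ℂ] 𝓜(ℂ, A) :=
  TensorProduct.lift <| LinearMap.mk₂ ℂ (fun m d => (m : 𝓜(ℂ, A)) * ι d)
    (fun m n d => add_mul _ _ _)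
    (fun c m d => smul_mul_assoc _ _ _)
    (fun m d d' => by rw [map_add, mul_add])
    (fun c m d => by rw [map_smul, mul_smul_comm])

theorem commutantTensorMap_tmul (ι : D →⋆ₙₐ[ℂ] 𝓜(ℂ, A)) (m : relativeCommutant ι) (d : D) :
    commutantTensorMap ι (m ⊗ₜ d) = m * ι d := rfl

/-- Multiplicativity and compatibility with the star both come from the commutation of `m` with `ι
d`. -/
theorem isStarTensorMap_commutantTensorMap (ι : D →⋆ₙₐ[ℂ] 𝓜(ℂ, A)) :
    IsStarTensorMap (commutantTensorMap ι) where
  map_mul x y := by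
    induction x with
    | zero => simp
    | add x x' hx hx' => rw [add_mul, map_add, map_add, add_mul, hx, hx']
    | tmul m d =>
      induction y with
      | zero => simp
      | add y y' hy hy' => rw [mul_add, map_add, map_add, mul_add, hy, hy']
      | tmul n d' =>
        rw [Algebra.TensorProduct.tmul_mul_tmul, commutantTensorMap_tmul, commutantTensorMap_tmul,
          commutantTensorMap_tmul, map_mul, mul_assoc, ← mul_assoc (ι d), ← (n.2 d).1]
        simp only [MulMemClass.coe_mul, mul_assoc]
  map_star x := by
    induction x with
    | zero => simp
    | add x y hx hy => rw [star_add, map_add, map_add, star_add, hx, hy]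
    | tmul m d =>
      rw [TensorProduct.star_tmul, commutantTensorMap_tmul, commutantTensorMap_tmul,
        (m.2 d).1, star_mul, map_star]
      rfl
  continuous_right m := by
    have h : Continuous ι := AddMonoidHomClass.continuous_of_bound ι 1 fun d => by
      rw [one_mul]; exact NonUnitalStarAlgHom.norm_apply_le ι d
    exact h.const_mul (m : 𝓜(ℂ, A))

variable {ι : D →⋆ₙₐ[ℂ] 𝓜(ℂ, A)} {I : Type*} {E : I → I → D}

/-- A multiplier in the relative commutant is determined by its product with one matrix unit. -/
theorem IsNondegenerate.eq_zero_of_mul_eq_zero (hι : IsNondegenerate ι) (hE : IsMatrixUnits E)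
    (hdense : Dense (Submodule.span ℂ (Set.range fun p : I × I => E p.1 p.2) : Set D))
    (m : relativeCommutant ι) (i j : I) (h : (m : 𝓜(ℂ, A)) * ι (E i j) = 0) : m = 0 := by
  -- Here `E p q = E p i * E i j * E j q`, and `m` commutes past the first factor.
  have h1 : ∀ p q, (m : 𝓜(ℂ, A)) * ι (E p q) = 0 := by
    intro p q
    rw [← hE.mul_same p j q, ← hE.mul_same p i j, map_mul, map_mul, ← mul_assoc, ← mul_assoc,
      (m.2 _).1, mul_assoc (ι (E p i)), h, mul_zero, zero_mul]
  have h2 : (m : 𝓜(ℂ, A)).fst = 0 := by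
    ext x
    refine (m : 𝓜(ℂ, A)).fst.mem_of_dense_span (hι.dense_fst hdense) (U := ⊥)
      isClosed_singleton ?_ x
    rintro _ ⟨p, q, a, rfl⟩
    exact congrArg (fun n : 𝓜(ℂ, A) => n.fst a) (h1 p q)
  apply Subtype.ext
  rw [ZeroMemClass.coe_zero, ← norm_eq_zero, ← DoubleCentralizer.norm_fst, h2, norm_zero]

theorem IsNondegenerate.exists_starAlgEquiv (hι : IsNondegenerate ι) (hE : IsMatrixUnits E)
    (hdense : Dense (Submodule.span ℂ (Set.range fun p : I × I => E p.1 p.2) : Set D)) :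
    ∃ θ : MinTensor (relativeCommutant ι) D ≃⋆ₐ[ℂ] A,
      ∀ (m : relativeCommutant ι) (d : D),
        (θ (MinTensor.tmul m d) : 𝓜(ℂ, A)) = (m : 𝓜(ℂ, A)) * ι d := by
  have hf := isStarTensorMap_commutantTensorMap ι
  obtain ⟨g, hg, hgf⟩ := MinTensor.exists_extension hf fun x => by
    rw [← MinTensor.norm_of]
    refine hE.norm_map_eq hdense hf (fun m i j h => hι.eq_zero_of_mul_eq_zero hE hdense m i j h)
      MinTensor.isStarTensorMap_of (fun m i j h => ?_) x
    by_contra hm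
    exact MinTensor.tmul_ne_zero hm (hE.ne_zero i j) h
  have hA : IsClosed (Set.range (DoubleCentralizer.coe ℂ : A → 𝓜(ℂ, A))) :=
    isometry_coeMultiplier.isClosedEmbedding.isClosed_range
  -- Both ranges are closed, being ranges of isometries on complete spaces, so each inclusion is
  -- checked on a set with dense span.
  have hrange : Set.range g = Set.range (DoubleCentralizer.coeHom (𝕜 := ℂ) (A := A)) := by
    apply Set.Subset.antisymm
    · rintro _ ⟨x, rfl⟩
      refine MinTensor.denseRange_of.induction_on
        (p := fun x => g x ∈ Set.range (DoubleCentralizer.coe ℂ : A → 𝓜(ℂ, A))) x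
        (hA.preimage hg.continuous) fun y => ?_
      rw [hgf]
      change _ ∈ LinearMap.range (coeMultiplierL A).toLinearMap
      induction y with
      | zero => rw [map_zero]; exact Submodule.zero_mem _
      | add y z hy hz => rw [map_add]; exact Submodule.add_mem _ hy hz
      | tmul m d => exact (m.2 d).2
    · rintro _ ⟨a, rfl⟩
      refine (coeMultiplierL A).mem_of_dense_span (hι.dense_fst_snd hE hdense)
        (U := LinearMap.range (g : MinTensor (relativeCommutant ι) D →ₗ[ℂ] 𝓜(ℂ, A)))
        hg.isClosedEmbedding.isClosed_range ?_ a
      rintro _ ⟨i, p, q, l, b, rfl⟩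
      obtain ⟨m, hm, hml⟩ := hι.exists_mem_relativeCommutant hE hdense b p q
      -- By the choice of `m`, its product with `ι (E i l)` is `ι (E i p) b ι (E q l)`, the given
      -- element.
      refine ⟨MinTensor.tmul ⟨m, hm⟩ (E i l), ?_⟩
      change g (MinTensor.of _) = DoubleCentralizer.coe ℂ _
      rw [hgf, commutantTensorMap_tmul, hml, ← DoubleCentralizer.mul_coe,
        ← DoubleCentralizer.coe_mul, mul_assoc]
  obtain ⟨θ, hθ⟩ := exists_starAlgEquiv_of_range_eq hg.injective
    isometry_coeMultiplier.injective hrange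
  exact ⟨θ, fun m d => (hθ _).trans (hgf _)⟩

end Commutant

theorem propositionA2 {A : Type u} [NonUnitalCStarAlgebra A]
    {H : Type v} [NormedAddCommGroup H] [InnerProductSpace ℂ H] [CompleteSpace H]
    (ι : compactOperators H →⋆ₙₐ[ℂ] 𝓜(ℂ, A)) (hι : IsNondegenerate ι) :
    ∃ θ : MinTensor (relativeCommutant ι) (compactOperators H) ≃⋆ₐ[ℂ] A,
      ∀ (m : relativeCommutant ι) (k : compactOperators H),
        (θ (MinTensor.tmul m k) : 𝓜(ℂ, A)) = (m : 𝓜(ℂ, A)) * ι k := by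
  obtain ⟨_, b, _⟩ := exists_hilbertBasis ℂ H
  exact hι.exists_starAlgEquiv b.isMatrixUnits b.dense_span_compactRankOne
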